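/- There is a universal constant $C>0$ such that the following holds. Let $n\ge 0$ and $0\le k_1<k_2\le 2^n$ be integers and let $0<\delta<1$. The weight of a function $f:\{0,1\}^n\to\{0,1\}$ is $wt(f)=|\{x\in\{0,1\}^n : f(x)=1\}|$, and $f$ is accessed through the blackbox operator $U_f:|x\rangle|b\rangle\mapsto|x\rangle|b\oplus f(x)\rangle$, where $x\in\{0,1\}^n$ and $b\in\{0,1\}$. Then there is a quantum query algorithm (it starts in $|0\cdots 0\rangle$ on $n$ input qubits, one target qubit and finitely many work qubits, alternates unitaries that do not depend on $f$ with calls to $U_f$, finally measures the target qubit in the computational basis, and accepts if and only if the outcome is $1$) that makes at most $$C\cdot\frac{\sqrt{2^n}}{\sqrt{k_2}-\sqrt{k_1}}\cdot\log\frac1\delta$$ calls to $U_f$ on every $f$ and decides the Weight Decision problem $\mathrm{WDP}_{k_1,k_2}$ with error probability at most $\delta$: for every $f$ with $wt(f)\ge k_2$ it accepts with probability at least $1-\delta$, and for every $f$ with $wt(f)\le k_1$ it accepts with probability at most $\delta$. In particular, for constant error (say $\delta=1/3$), $O\big(\sqrt{2^n}/(\sqrt{k_2}-\sqrt{k_1})\big)$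 calls suffice. -/

import Mathlib

namespace WeightDecision

/-- Bit strings of length `n`. -/
abbrev Bits (n : ℕ) : Type := Fin n → Bool

/-- The weight of an `n`-bit Boolean function: the number of inputs on which it takes the value 1. -/
def wt {n : ℕ} (f : Bits n → Bool) : ℕ :=
  (Finset.univ.filter fun x => f x = true).card

/-- Computational basis of a register of `n` input qubits `x`, one target qubit `b`
and `m` work qubits `w`. -/
abbrev Basis (n m : ℕ) : Type := Bits n × Bool × Bits m

/-- (Unnormalised) pure states of the register, as amplitude vectors. -/
abbrev State (n m : ℕ) : Type := Basis n m → ℂ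

/-- The basis state `|s⟩`. -/
def ket {n m : ℕ} (s : Basis n m) : State n m := Pi.single s 1

/-- The all-zero initial state `|0ⁿ⟩|0⟩|0ᵐ⟩`. -/
def initState (n m : ℕ) : State n m :=
  ket ((fun _ => false), false, (fun _ => false))

/-- The blackbox operator `U_f ⊗ I : |x⟩|b⟩|w⟩ ↦ |x⟩|b ⊕ f x⟩|w⟩`, extended linearly
(see `oracle_ket` for its action on basis states). -/
def oracle {n m : ℕ} (f : Bits n → Bool) : State n m →ₗ[ℂ] State n m where
  toFun ψ := fun s => ψ (s.1, xor s.2.1 (f s.1), s.2.2)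
  map_add' _ _ := rfl
  map_smul' _ _ := rfl

theorem oracle_ket {n m : ℕ} (f : Bits n → Bool) (x : Bits n) (b : Bool) (w : Bits m) :
    oracle f (ket (x, b, w)) = ket (x, xor b (f x), w) := by
  funext s
  obtain ⟨x', b', w'⟩ := s
  simp only [oracle, ket, LinearMap.coe_mk, AddHom.coe_mk, Pi.single_apply, Prod.mk.injEq]
  refine if_congr ?_ rfl rfl
  constructor
  · rintro ⟨rfl, h, rfl⟩
    exact ⟨rfl, by rw [← h]; simp, rfl⟩
  · rintro ⟨rfl, h, rfl⟩
    exact ⟨rfl, by rw [h]; simp, rfl⟩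

/-- A quantum query algorithm for `n`-bit Boolean functions: a number of work qubits, a number
`queries` of calls to the blackbox, and unitaries that do not depend on the function.
The unitaries used are `gate 0, …, gate queries`. -/
structure QueryAlgorithm (n : ℕ) where
  work : ℕ
  queries : ℕ
  gate : ℕ → Matrix.unitaryGroup (Basis n work) ℂ

namespace QueryAlgorithm

/-- The state after `t` queries, each followed by its unitary:
`gate t · U_f · gate (t-1) · U_f ⋯ U_f · gate 0 |0…0⟩`. -/
def stateAfter {n : ℕ} (A : QueryAlgorithm n) (f : Bits n → Bool) : ℕ → State n A.work
  | 0 => (A.gate 0 : Matrix (Basis n A.work) (Basis n A.work) ℂ).mulVec (initState n A.work)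
  | t + 1 => (A.gate (t + 1) : Matrix (Basis n A.work) (Basis n A.work) ℂ).mulVec
      (oracle f (A.stateAfter f t))

/-- The probability that the algorithm accepts `f`: after `queries` queries the target qubit is
measured in the computational basis, and the algorithm accepts if the outcome is `1`. -/
noncomputable def acceptProb {n : ℕ} (A : QueryAlgorithm n) (f : Bits n → Bool) : ℝ :=
  ∑ x : Bits n, ∑ w : Bits A.work, ‖A.stateAfter f A.queries (x, true, w)‖ ^ 2

/-- `A` decides whether `wt f ≤ k₁` (reject) or `wt f ≥ k₂` (accept), under the promise that
one of the two holds, with error probability at most `δ` on every promised input. -/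
def DecidesWeight {n : ℕ} (A : QueryAlgorithm n) (k₁ k₂ : ℕ) (δ : ℝ) : Prop :=
  ∀ f : Bits n → Bool,
    (wt f ≤ k₁ → A.acceptProb f ≤ δ) ∧ (k₂ ≤ wt f → 1 - δ ≤ A.acceptProb f)

end QueryAlgorithm

end WeightDecision

/-! The proof is amplitude estimation. With `sin θ = √(wt f / 2ⁿ)`, the uniform superposition is a
sum of two eigenvectors of the Grover iteration, with eigenvalues `μ = exp(±2iθ)` (`grover_eq`).
Both satisfy `|1 - μ| = 2 √(wt f / 2ⁿ)`, so estimating either one estimates `√(wt f)`. The two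
promised cases are separated by a threshold at distance at least `η = (√k₂ - √k₁) / √2ⁿ` on each
side.

One phase estimation uses a control register `ZMod L` with `L` of order `1 / η`. The Fourier
transform diagonalises the cyclic shift, and a smooth window `a` makes `j ↦ a j * μ ^ j` almost an
eigenvector of the shift. A second-moment bound then makes an outcome at distance `η` or more from
`μ` unlikely (`sum_phase_sub_sq`, `exists_window`, `sum_far_phase_le`).

To reach error `δ`, a single Grover register is iterated `w₁ + ⋯ + w_R` times. On an eigenvector the
phase `μ ^ (w₁ + ⋯ + w_R)` factors, so the outcomes are `R` independent estimates of the same `μ`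
(`tensorPower_sum_mul_pow`), and a majority vote errs with probability exponentially small in `R`
(`sum_majority_le`).

Queries cannot be switched off, but they are inert when the target qubit is `|+⟩`; this gives the
controlled iterations (`stepGate_mulVec_oracle`). -/

namespace WeightDecision

open Matrix
open scoped Kronecker

/-! ### Unitary matrices acting on amplitude vectors -/

section LinearAlgebra

variable {ι κ : Type*} [Fintype ι] [Fintype κ]

theorem sum_normSq_mulVec [DecidableEq ι] {U : Matrix ι ι ℂ} (hU : U ∈ unitaryGroup ι ℂ) (v : ι → ℂ) :
    ∑ i, ‖(U *ᵥ v) i‖ ^ 2 = ∑ i, ‖v i‖ ^ 2 := by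
  have key : ∀ w : ι → ℂ, ((∑ i, ‖w i‖ ^ 2 : ℝ) : ℂ) = star w ⬝ᵥ w := by
    intro w
    simp only [dotProduct, Pi.star_apply, Complex.ofReal_sum, RCLike.star_def, Complex.conj_mul',
      Complex.ofReal_pow]
  have h : star (U *ᵥ v) ⬝ᵥ (U *ᵥ v) = star v ⬝ᵥ v := by
    rw [star_mulVec, dotProduct_mulVec, vecMul_vecMul, ← star_eq_conjTranspose,
      mem_unitaryGroup_iff'.mp hU, vecMul_one]
  exact_mod_cast (key _).trans (h.trans (key v).symm)

/-- Every unit vector is the image of a given basis vector under some unitary. -/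
theorem exists_unitary_mulVec_single [DecidableEq ι] (v : ι → ℂ) (hv : ∑ i, ‖v i‖ ^ 2 = 1) (i₀ : ι) :
    ∃ U : unitaryGroup ι ℂ, (U : Matrix ι ι ℂ) *ᵥ Pi.single i₀ 1 = v := by
  have hnorm : ‖(WithLp.toLp 2 v : EuclideanSpace ℂ ι)‖ = 1 := by
    rw [EuclideanSpace.norm_eq]
    simp [hv]
  have ho : Orthonormal ℂ
      (({i₀} : Set ι).domRestrict fun _ => (WithLp.toLp 2 v : EuclideanSpace ℂ ι)) := by
    refine ⟨fun _ => hnorm, fun i j hij => absurd (Subsingleton.elim i j) hij⟩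
  obtain ⟨b, hb⟩ := ho.exists_orthonormalBasis_extension_of_card_eq (by simp)
  refine ⟨⟨_, (EuclideanSpace.basisFun ι ℂ).toMatrix_orthonormalBasis_mem_unitary b⟩, ?_⟩
  rw [mulVec_single_one]
  funext i
  simp [Matrix.col, Module.Basis.toMatrix_apply, hb i₀ rfl]

theorem blockDiagonal_mem_unitaryGroup [DecidableEq ι] [DecidableEq κ] {M : κ → Matrix ι ι ℂ}
    (hM : ∀ k, M k ∈ unitaryGroup ι ℂ) : blockDiagonal M ∈ unitaryGroup (ι × κ) ℂ := by
  rw [mem_unitaryGroup_iff, star_eq_conjTranspose, blockDiagonal_conjTranspose,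
    ← blockDiagonal_mul, ← blockDiagonal_one]
  congr 1
  funext k
  exact mem_unitaryGroup_iff.mp (hM k)

theorem blockDiagonal_mulVec_apply [DecidableEq κ] (M : κ → Matrix ι ι ℂ) (v : ι × κ → ℂ) (i : ι) (k : κ) :
    (blockDiagonal M *ᵥ v) (i, k) = (M k *ᵥ fun j => v (j, k)) i := by
  simp [mulVec, dotProduct, Fintype.sum_prod_type, blockDiagonal_apply]

theorem one_kronecker_mulVec_apply [DecidableEq ι] (M : Matrix κ κ ℂ) (v : ι × κ → ℂ) (i : ι) (k : κ) :
    (((1 : Matrix ι ι ℂ) ⊗ₖ M) *ᵥ v) (i, k) = (M *ᵥ fun j => v (i, j)) k := by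
  simp [mulVec, dotProduct, Fintype.sum_prod_type, kroneckerMap_apply, one_apply]

end LinearAlgebra

/-! ### Grover iterations -/

/-- The inversion about the mean. -/
noncomputable def diffusion (ι : Type*) [Fintype ι] [DecidableEq ι] : Matrix ι ι ℂ :=
  Matrix.of fun i j => 2 / (Fintype.card ι : ℂ) - if i = j then 1 else 0

section Diffusion

variable {ι : Type*} [Fintype ι] [DecidableEq ι]

theorem diffusion_mulVec_apply (v : ι → ℂ) (i : ι) :
    (diffusion ι *ᵥ v) i = 2 / (Fintype.card ι : ℂ) * ∑ j, v j - v i := by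
  simp [diffusion, mulVec, dotProduct, sub_mul, Finset.sum_sub_distrib, Finset.mul_sum]

theorem diffusion_mem_unitaryGroup [Nonempty ι] : diffusion ι ∈ unitaryGroup ι ℂ := by
  have hc : (Fintype.card ι : ℂ) ≠ 0 := by exact_mod_cast Fintype.card_ne_zero
  have hs : star (diffusion ι) = diffusion ι := by
    ext i j
    rcases eq_or_ne i j with rfl | h
    · simp [diffusion, star_apply]
    · simp [diffusion, star_apply, h, h.symm]
  rw [mem_unitaryGroup_iff, hs]
  refine Matrix.ext_of_mulVec_single fun k => ?_
  rw [← mulVec_mulVec]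
  funext i
  rw [diffusion_mulVec_apply]
  simp only [diffusion_mulVec_apply, Finset.sum_sub_distrib, Finset.sum_const, Finset.card_univ,
    nsmul_eq_mul, one_mulVec]
  field_simp
  ring

end Diffusion

/-- The state of the input register after `t` Grover iterations from the uniform superposition. -/
noncomputable def grover {n : ℕ} (f : Bits n → Bool) : ℕ → Bits n → ℂ
  | 0 => fun _ => ((1 / Real.sqrt (2 ^ n) : ℝ) : ℂ)
  | t + 1 => diffusion (Bits n) *ᵥ fun x => (if f x then -1 else 1) * grover f t x

theorem sum_normSq_grover {n : ℕ} (f : Bits n → Bool) (t : ℕ) :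
    ∑ x, ‖grover f t x‖ ^ 2 = 1 := by
  induction t with
  | zero =>
    simp [grover, Complex.norm_real, abs_of_nonneg]
  | succ t ih =>
    rw [grover, sum_normSq_mulVec diffusion_mem_unitaryGroup, ← ih]
    refine Finset.sum_congr rfl fun x _ => ?_
    split_ifs <;> simp

/-! ### Controlled Grover iterations as a query algorithm -/

section Construction

variable {n m : ℕ}

/-- Amplitudes of the target qubit: `|−⟩` if `q` holds and `|+⟩` otherwise. -/
noncomputable def targetAmp (q b : Bool) : ℂ :=
  (if q && b then -1 else 1) * ((1 / Real.sqrt 2 : ℝ) : ℂ)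

/-- Phase kickback: flipping the target negates `|−⟩` and fixes `|+⟩`, so the target alone decides
whether a query acts as a phase oracle or does nothing. -/
theorem targetAmp_xor (q b c : Bool) :
    targetAmp q (xor b c) = (if q && c then -1 else 1) * targetAmp q b := by
  cases q <;> cases b <;> cases c <;> simp [targetAmp]

/-- The superposition in which the branch with control value `w` has undergone `min t (p w)`
Grover iterations; the target qubit of a branch is `|−⟩` as long as iterations remain. -/
noncomputable def controlledState (a : Bits m → ℂ) (p : Bits m → ℕ) (f : Bits n → Bool) (t : ℕ) :
    State n m :=
  fun s => a s.2.2 * grover f (min t (p s.2.2)) s.1 * targetAmp (decide (t < p s.2.2)) s.2.1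

theorem sum_normSq_targetAmp (q : Bool) : ∑ b, ‖targetAmp q b‖ ^ 2 = 1 := by
  have h : (Real.sqrt 2)⁻¹ ^ 2 = 1 / 2 := by
    rw [inv_pow, Real.sq_sqrt zero_le_two, one_div]
  rw [Fintype.sum_bool]
  cases q <;> simp only [targetAmp, Bool.and_true, Bool.and_false, norm_mul, mul_pow] <;>
    simp [abs_of_nonneg, h] <;> norm_num

theorem sum_normSq_controlledState (a : Bits m → ℂ) (ha : ∑ w, ‖a w‖ ^ 2 = 1) (p : Bits m → ℕ)
    (f : Bits n → Bool) (t : ℕ) : ∑ s, ‖controlledState a p f t s‖ ^ 2 = 1 := by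
  calc ∑ s, ‖controlledState a p f t s‖ ^ 2
      = ∑ w, ∑ x : Bits n, ∑ b, ‖a w‖ ^ 2 * ‖grover f (min t (p w)) x‖ ^ 2 *
          ‖targetAmp (decide (t < p w)) b‖ ^ 2 := by
        simp only [controlledState, Fintype.sum_prod_type, norm_mul, mul_pow]
        rw [Finset.sum_comm' (t' := Finset.univ) (s' := fun _ => Finset.univ) (by simp)]
        rw [Finset.sum_comm]
        rw [Finset.sum_congr rfl fun x _ => Finset.sum_comm]
        rw [Finset.sum_comm]
    _ = 1 := by
        simp only [← Finset.mul_sum, sum_normSq_targetAmp, sum_normSq_grover, mul_one, ha]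

/-- The gate following the `t`-th query, making one Grover iteration in the active branches. -/
noncomputable def stepGate (n : ℕ) (p : Bits m → ℕ) (t : ℕ) :
    Matrix (Basis n m) (Basis n m) ℂ :=
  blockDiagonal fun k : Bool × Bits m =>
    (if (decide (t + 1 = p k.2) && k.1) then (-1 : ℂ) else 1) •
      if t < p k.2 then diffusion (Bits n) else 1

theorem stepGate_mem_unitaryGroup (p : Bits m → ℕ) (t : ℕ) :
    stepGate n p t ∈ unitaryGroup (Basis n m) ℂ := by
  refine blockDiagonal_mem_unitaryGroup fun k => ?_
  have h : (if t < p k.2 then diffusion (Bits n) else 1) ∈ unitaryGroup (Bits n) ℂ := by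
    split_ifs
    · exact diffusion_mem_unitaryGroup
    · exact one_mem _
  split_ifs at h ⊢ <;> simp_all [mem_unitaryGroup_iff]

theorem stepGate_mulVec_oracle (a : Bits m → ℂ) (p : Bits m → ℕ) (f : Bits n → Bool) (t : ℕ) :
    stepGate n p t *ᵥ oracle f (controlledState a p f t) = controlledState a p f (t + 1) := by
  funext ⟨x, b, w⟩
  have horacle : (fun x' => oracle f (controlledState a p f t) (x', b, w)) =
      (a w * targetAmp (decide (t < p w)) b) • fun x' =>
        (if decide (t < p w) && f x' then -1 else 1) * grover f (min t (p w)) x' := by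
    funext x'
    simp only [oracle, LinearMap.coe_mk, AddHom.coe_mk, controlledState, targetAmp_xor,
      Pi.smul_apply, smul_eq_mul]
    ring
  rw [stepGate, blockDiagonal_mulVec_apply, horacle, smul_mulVec, mulVec_smul]
  simp only [Pi.smul_apply, smul_eq_mul, controlledState]
  rcases lt_trichotomy (t + 1) (p w) with h | h | h
  · have h1 : t < p w := by omega
    simp only [h, h1, h.ne, if_true, decide_true, decide_false, Bool.true_and, Bool.false_and,
      min_eq_left h.le, min_eq_left h1.le, grover]
    simp
    ring
  -- Last active iteration: the sign that `stepGate` puts on `b = true` turns `|−⟩` into `|+⟩`,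
  -- making later queries inert in this branch.
  · have h1 : t < p w := by omega
    have h2 : ¬ t + 1 < p w := by omega
    simp only [h, h1, if_true, decide_true, Bool.true_and, min_eq_left h1.le, min_self]
    rw [← h, grover]
    cases b <;> simp [targetAmp] <;> ring
  · have h1 : ¬ t < p w := by omega
    have h2 : ¬ t + 1 < p w := by omega
    simp [h1, h2, h.ne', min_eq_right h.le, min_eq_right (not_lt.mp h1)]
    ring

/-- The Hadamard gate. -/
noncomputable def hadamard : Matrix Bool Bool ℂ := Matrix.of targetAmp

theorem hadamard_mem_unitaryGroup : hadamard ∈ unitaryGroup Bool ℂ := by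
  have h : ((Real.sqrt 2 : ℝ) : ℂ) * (Real.sqrt 2 : ℝ) = 2 := by
    exact_mod_cast Real.mul_self_sqrt zero_le_two
  rw [mem_unitaryGroup_iff]
  ext b c
  cases b <;> cases c <;>
    simp [hadamard, targetAmp, mul_apply, star_apply, ← mul_inv, h] <;> norm_num

/-- The gate flipping a qubit if `c` holds. -/
def flip (c : Bool) : Matrix Bool Bool ℂ := Matrix.of fun b b' => if xor b c = b' then 1 else 0

theorem flip_mem_unitaryGroup (c : Bool) : flip c ∈ unitaryGroup Bool ℂ := by
  rw [mem_unitaryGroup_iff]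
  ext b b'
  cases b <;> cases b' <;> cases c <;> simp [flip, mul_apply, star_apply]

/-- The gate applying `F` to the work register and writing the decision to the target qubit. -/
noncomputable def finalGate (n : ℕ) (F : Matrix (Bits m) (Bits m) ℂ) (acc : Bits m → Bool) :
    Matrix (Basis n m) (Basis n m) ℂ :=
  (1 : Matrix (Bits n) (Bits n) ℂ) ⊗ₖ
    (blockDiagonal (fun y => flip (acc y)) * (hadamard ⊗ₖ F))

theorem finalGate_mem_unitaryGroup {F : Matrix (Bits m) (Bits m) ℂ}
    (hF : F ∈ unitaryGroup (Bits m) ℂ) (acc : Bits m → Bool) :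
    finalGate n F acc ∈ unitaryGroup (Basis n m) ℂ :=
  kronecker_mem_unitary (one_mem _) (mul_mem
    (blockDiagonal_mem_unitaryGroup fun y => flip_mem_unitaryGroup (acc y))
    (kronecker_mem_unitary hadamard_mem_unitaryGroup hF))

theorem finalGate_mulVec_apply (F : Matrix (Bits m) (Bits m) ℂ) (acc : Bits m → Bool)
    (φ : Bits n → Bits m → ℂ) (x : Bits n) (y : Bits m) :
    (finalGate n F acc *ᵥ fun s => φ s.1 s.2.2 * targetAmp false s.2.1) (x, true, y) =
      if acc y then ∑ w, F y w * φ x w else 0 := by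
  have h : ((Real.sqrt 2 : ℝ) : ℂ) * (Real.sqrt 2 : ℝ) = 2 := by
    exact_mod_cast Real.mul_self_sqrt zero_le_two
  rw [finalGate, one_kronecker_mulVec_apply, ← mulVec_mulVec, blockDiagonal_mulVec_apply]
  have hk : ∀ b, ((hadamard ⊗ₖ F) *ᵥ fun j : Bool × Bits m => φ x j.2 * targetAmp false j.1)
      (b, y) = if b then 0 else ∑ w, F y w * φ x w := by
    intro b
    have : ∀ b' w, hadamard b b' * F y w * (φ x w * targetAmp false b') =
        hadamard b b' * targetAmp false b' * (F y w * φ x w) := by intros; ring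
    simp only [mulVec, dotProduct, Fintype.sum_prod_type, kroneckerMap_apply, this,
      ← Finset.mul_sum, ← Finset.sum_mul]
    cases b <;> simp [hadamard, targetAmp, ← mul_inv, h]
  simp only [hk]
  cases acc y <;> simp [flip, mulVec, dotProduct]

/-- Preparation by `U`, `T` controlled Grover iterations, and the final gate. -/
noncomputable def controlledGates (U : unitaryGroup (Basis n m) ℂ) (p : Bits m → ℕ) (T : ℕ)
    (F : unitaryGroup (Bits m) ℂ) (acc : Bits m → Bool) : ℕ → unitaryGroup (Basis n m) ℂ
  | 0 => U
  | t + 1 => if t < T then ⟨stepGate n p t, stepGate_mem_unitaryGroup p t⟩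
    else ⟨finalGate n F acc, finalGate_mem_unitaryGroup F.2 acc⟩

/-- Controlled Grover iterations followed by a measurement of the control register. -/
noncomputable def controlledGrover (U : unitaryGroup (Basis n m) ℂ) (p : Bits m → ℕ) (T : ℕ)
    (F : unitaryGroup (Bits m) ℂ) (acc : Bits m → Bool) : QueryAlgorithm n where
  work := m
  -- Every gate after `gate 0` follows a query. The extra query before the final gate finds the
  -- target in `|+⟩` in all branches and has no effect.
  queries := T + 1
  gate := controlledGates U p T F acc

theorem stateAfter_controlledGrover (U : unitaryGroup (Basis n m) ℂ) (a : Bits m → ℂ)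
    (p : Bits m → ℕ) (T : ℕ) (F : unitaryGroup (Bits m) ℂ) (acc : Bits m → Bool)
    (f : Bits n → Bool)
    (hU : (U : Matrix (Basis n m) (Basis n m) ℂ) *ᵥ initState n m = controlledState a p f 0)
    (t : ℕ) (ht : t ≤ T) :
    (controlledGrover U p T F acc).stateAfter f t = controlledState a p f t := by
  induction t with
  | zero => exact hU
  | succ t ih =>
    rw [← stepGate_mulVec_oracle, ← ih (by omega), QueryAlgorithm.stateAfter]
    have hgate : controlledGates U p T F acc (t + 1) =
        ⟨stepGate n p t, stepGate_mem_unitaryGroup p t⟩ := if_pos ht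
    rw [show (controlledGrover U p T F acc).gate (t + 1) = _ from hgate]
    rfl

/-- Controlled Grover iterations followed by a measurement of the control register, as a query
algorithm with `T + 1` queries, where `T` bounds the number of iterations. -/
theorem exists_queryAlgorithm_controlled_grover (n : ℕ) {m : ℕ} (a : Bits m → ℂ)
    (ha : ∑ w, ‖a w‖ ^ 2 = 1) (p : Bits m → ℕ) (T : ℕ) (hp : ∀ w, p w ≤ T)
    {F : Matrix (Bits m) (Bits m) ℂ} (hF : F ∈ unitaryGroup (Bits m) ℂ) (acc : Bits m → Bool) :
    ∃ A : QueryAlgorithm n, A.queries = T + 1 ∧ ∀ f : Bits n → Bool,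
      A.acceptProb f =
        ∑ x, ∑ y, if acc y then ‖∑ w, F y w * (a w * grover f (p w) x)‖ ^ 2 else 0 := by
  obtain ⟨U, hU⟩ := exists_unitary_mulVec_single (controlledState (n := n) a p (fun _ => false) 0)
    (sum_normSq_controlledState a ha p _ 0) ((fun _ => false), false, (fun _ => false))
  refine ⟨controlledGrover U p T ⟨F, hF⟩ acc, rfl, fun f => ?_⟩
  -- At time 0 no iteration has been made, so the state prepared for the constant function serves
  -- every `f`.
  have hU' : (U : Matrix (Basis n m) (Basis n m) ℂ) *ᵥ initState n m =
      controlledState a p f 0 := by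
    refine hU.trans ?_
    funext s
    simp [controlledState, grover]
  have hT : oracle f (controlledState a p f T) =
      fun s => (fun x w => a w * grover f (p w) x) s.1 s.2.2 * targetAmp false s.2.1 := by
    funext ⟨x, b, w⟩
    simp [oracle, controlledState, not_lt.mpr (hp w), min_eq_right (hp w), targetAmp_xor]
  have hfinal : (controlledGrover U p T ⟨F, hF⟩ acc).stateAfter f (T + 1) =
      finalGate n F acc *ᵥ
        fun s => (fun x w => a w * grover f (p w) x) s.1 s.2.2 * targetAmp false s.2.1 := by
    rw [← hT, ← stateAfter_controlledGrover U a p T ⟨F, hF⟩ acc f hU' T le_rfl,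
      QueryAlgorithm.stateAfter]
    have hgate : controlledGates (n := n) U p T ⟨F, hF⟩ acc (T + 1) =
        ⟨finalGate n F acc, finalGate_mem_unitaryGroup hF acc⟩ := if_neg (lt_irrefl T)
    rw [show (controlledGrover U p T ⟨F, hF⟩ acc).gate (T + 1) = _ from hgate]
    rfl
  have hamp : ∀ (x : Bits n) (y : Bits m),
      (controlledGrover U p T ⟨F, hF⟩ acc).stateAfter f (T + 1) (x, true, y) =
        if acc y then ∑ w, F y w * (a w * grover f (p w) x) else 0 := by
    intro x y
    rw [hfinal]
    exact finalGate_mulVec_apply F acc (fun x w => a w * grover f (p w) x) x y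
  refine Finset.sum_congr rfl fun x _ => Finset.sum_congr rfl fun y _ => ?_
  refine (congrArg (fun z : ℂ => ‖z‖ ^ 2) (hamp x y)).trans ?_
  split_ifs <;> simp

/-- An algorithm that tosses a fair coin without making queries. -/
theorem exists_queryAlgorithm_coin (n : ℕ) :
    ∃ A : QueryAlgorithm n, A.queries = 0 ∧ ∀ f : Bits n → Bool, A.acceptProb f = 1 / 2 := by
  have hs : ((Real.sqrt 2)⁻¹) ^ 2 = 1 / 2 := by
    rw [inv_pow, Real.sq_sqrt zero_le_two, one_div]
  let v : State n 0 := fun s => if s.1 = (fun _ => false) then targetAmp false s.2.1 else 0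
  have hv : ∑ s, ‖v s‖ ^ 2 = 1 := by
    simp only [v, Fintype.sum_prod_type, apply_ite (fun z : ℂ => ‖z‖ ^ 2)]
    simp [targetAmp, hs, abs_of_nonneg]
  obtain ⟨U, hU⟩ := exists_unitary_mulVec_single v hv ((fun _ => false), false, (fun _ => false))
  refine ⟨⟨0, 0, fun _ => U⟩, rfl, fun f => ?_⟩
  simp only [QueryAlgorithm.acceptProb, QueryAlgorithm.stateAfter, initState, ket]
  rw [hU]
  simp only [v, apply_ite (fun z : ℂ => ‖z‖ ^ 2)]
  simp [targetAmp, hs, abs_of_nonneg]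

end Construction

/-! ### Spectral decomposition of the Grover iteration -/

section GroverEigen

variable {n : ℕ}

theorem sum_ite_eq_wt {M : Type*} [Ring M] (f : Bits n → Bool) (u v : M) :
    ∑ x, (if f x then u else v) = wt f * u + (2 ^ n - wt f) * v := by
  have h1 : (Finset.univ.filter fun x : Bits n => ¬ f x = true).card + wt f = 2 ^ n := by
    rw [wt, add_comm, Finset.card_filter_add_card_filter_not]
    simp
  have h2 : ((Finset.univ.filter fun x : Bits n => ¬ f x = true).card : M) = 2 ^ n - wt f := by
    rw [eq_sub_iff_add_eq, ← Nat.cast_add, h1, Nat.cast_pow, Nat.cast_ofNat]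
  rw [Finset.sum_ite, Finset.sum_const, Finset.sum_const, nsmul_eq_mul, nsmul_eq_mul, h2]
  rfl

theorem wt_le (f : Bits n → Bool) : wt f ≤ 2 ^ n := by
  refine (Finset.card_filter_le _ _).trans ?_
  simp

/-- The square root of the eigenvalue of the Grover iteration, for `ε = ±1`. -/
noncomputable def groverPhase (f : Bits n → Bool) (ε : ℝ) : ℂ :=
  ⟨Real.sqrt (2 ^ n - wt f) / Real.sqrt (2 ^ n), ε * (Real.sqrt (wt f) / Real.sqrt (2 ^ n))⟩

/-- An eigenvector of the Grover iteration, for `ε = ±1`. -/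
noncomputable def groverEigen (f : Bits n → Bool) (ε : ℝ) (x : Bits n) : ℂ :=
  if f x then groverPhase f ε * ((1 / (2 * Real.sqrt (wt f)) : ℝ) * (-(ε * Complex.I)))
  else groverPhase f ε * (1 / (2 * Real.sqrt (2 ^ n - wt f)) : ℝ)

theorem sqrt_wt_div_sq_add (f : Bits n → Bool) :
    (Real.sqrt (2 ^ n - wt f) / Real.sqrt (2 ^ n)) ^ 2 +
      (Real.sqrt (wt f) / Real.sqrt (2 ^ n)) ^ 2 = 1 := by
  have h : (wt f : ℝ) ≤ 2 ^ n := by exact_mod_cast wt_le f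
  rw [div_pow, div_pow, Real.sq_sqrt (by linarith), Real.sq_sqrt (by positivity),
    Real.sq_sqrt (by positivity), ← add_div, sub_add_cancel, div_self (by positivity)]

theorem groverPhase_re_sq_add (f : Bits n → Bool) {ε : ℝ} (hε : ε ^ 2 = 1) :
    (groverPhase f ε).re ^ 2 + (groverPhase f ε).im ^ 2 = 1 := by
  simp only [groverPhase]
  rw [mul_pow, hε, one_mul, sqrt_wt_div_sq_add]

theorem norm_groverPhase (f : Bits n → Bool) {ε : ℝ} (hε : ε ^ 2 = 1) :
    ‖groverPhase f ε‖ = 1 := by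
  rw [Complex.norm_eq_sqrt_sq_add_sq, groverPhase_re_sq_add f hε, Real.sqrt_one]

/-- For `|u| = 1`, `1 - u² = u (ū - u)`; the next lemma uses `1 + u² = u (ū + u)`. -/
theorem one_sub_groverPhase_sq (f : Bits n → Bool) {ε : ℝ} (hε : ε ^ 2 = 1) :
    1 - groverPhase f ε ^ 2 =
      -2 * Complex.I * (groverPhase f ε).im * groverPhase f ε := by
  have h := groverPhase_re_sq_add f hε
  apply Complex.ext <;> simp [pow_two] <;> nlinarith

theorem one_add_groverPhase_sq (f : Bits n → Bool) {ε : ℝ} (hε : ε ^ 2 = 1) :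
    1 + groverPhase f ε ^ 2 = 2 * (groverPhase f ε).re * groverPhase f ε := by
  have h := groverPhase_re_sq_add f hε
  apply Complex.ext <;> simp [pow_two] <;> nlinarith

theorem norm_one_sub_groverPhase_sq (f : Bits n → Bool) {ε : ℝ} (hε : ε ^ 2 = 1) :
    ‖1 - groverPhase f ε ^ 2‖ = 2 * (Real.sqrt (wt f) / Real.sqrt (2 ^ n)) := by
  have hε' : |ε| = 1 := by rw [← sq_eq_sq₀ (abs_nonneg _) zero_le_one, sq_abs, hε, one_pow]
  rw [one_sub_groverPhase_sq f hε, norm_mul, norm_groverPhase f hε]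
  simp only [groverPhase]
  simp [hε', abs_of_nonneg]

/-- Each value class of `f` contributes `1 / 4`. An empty class contributes 0, so equality fails at
weights 0 and `2 ^ n`. -/
theorem sum_normSq_groverEigen_le (f : Bits n → Bool) {ε : ℝ} (hε : ε ^ 2 = 1) :
    ∑ x, ‖groverEigen f ε x‖ ^ 2 ≤ 1 / 2 := by
  have hε' : |ε| = 1 := by rw [← sq_eq_sq₀ (abs_nonneg _) zero_le_one, sq_abs, hε, one_pow]
  have h : (wt f : ℝ) ≤ 2 ^ n := by exact_mod_cast wt_le f
  have key : ∀ y : ℝ, 0 ≤ y → y * (1 / (2 * Real.sqrt y)) ^ 2 ≤ 1 / 4 := by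
    intro y hy
    rcases hy.eq_or_lt with rfl | hy
    · simp
    · rw [div_pow, mul_pow, Real.sq_sqrt hy.le]
      apply le_of_eq
      field_simp
      norm_num
  have hx : ∀ x, ‖groverEigen f ε x‖ ^ 2 = if f x then (1 / (2 * Real.sqrt (wt f))) ^ 2
      else (1 / (2 * Real.sqrt (2 ^ n - wt f))) ^ 2 := by
    intro x
    rw [groverEigen]
    split_ifs <;> rw [norm_mul, norm_groverPhase f hε] <;> simp [hε', abs_of_nonneg]
  rw [Finset.sum_congr rfl fun x _ => hx x, sum_ite_eq_wt]
  have h1 := key (wt f) (Nat.cast_nonneg _)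
  have h2 := key (2 ^ n - wt f) (by linarith)
  linarith

theorem mul_one_div_two_mul_sqrt {y : ℝ} (hy : 0 ≤ y) :
    y * (1 / (2 * Real.sqrt y)) = Real.sqrt y / 2 := by
  rcases hy.eq_or_lt with rfl | hy
  · simp
  · have := Real.sqrt_pos.mpr hy
    field_simp
    rw [Real.sq_sqrt hy.le]

theorem wt_pos_of_eq_true {f : Bits n → Bool} {x : Bits n} (h : f x = true) : 0 < wt f :=
  Finset.card_pos.mpr ⟨x, by simp [h]⟩

theorem wt_lt_of_eq_false {f : Bits n → Bool} {x : Bits n} (h : f x = false) : wt f < 2 ^ n := by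
  have : wt f < (Finset.univ : Finset (Bits n)).card :=
    Finset.card_lt_card (Finset.filter_ssubset.mpr ⟨x, Finset.mem_univ x, by simp [h]⟩)
  simpa using this

/-- Twice the mean of the sign-flipped vector is `u² / √2ⁿ` with `u = groverPhase f ε`. What remains
is `1 + u² = 2 Re(u) u` where `f` is false and `1 - u² = -2i Im(u) u` where it is true. -/
theorem diffusion_mulVec_groverEigen (f : Bits n → Bool) {ε : ℝ} (hε : ε ^ 2 = 1) (x : Bits n) :
    (diffusion (Bits n) *ᵥ fun x => (if f x then -1 else 1) * groverEigen f ε x) x =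
      groverPhase f ε ^ 2 * groverEigen f ε x := by
  have hle : (wt f : ℝ) ≤ 2 ^ n := by exact_mod_cast wt_le f
  have hN : 0 < Real.sqrt ((2 : ℝ) ^ n) := by positivity
  have hNN : Real.sqrt ((2 : ℝ) ^ n) * Real.sqrt ((2 : ℝ) ^ n) = 2 ^ n :=
    Real.mul_self_sqrt (by positivity)
  have hNC : ((Real.sqrt ((2 : ℝ) ^ n) : ℝ) : ℂ) ≠ 0 := by exact_mod_cast hN.ne'
  have hNNC : ((Real.sqrt ((2 : ℝ) ^ n) : ℝ) : ℂ) * (Real.sqrt ((2 : ℝ) ^ n) : ℝ) = 2 ^ n := by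
    exact_mod_cast hNN
  have hu : groverPhase f ε = ((groverPhase f ε).re : ℂ) + (groverPhase f ε).im * Complex.I :=
    (Complex.re_add_im _).symm
  have hsum : 2 / (Fintype.card (Bits n) : ℂ) *
      ∑ x, (if f x then -1 else 1) * groverEigen f ε x =
        groverPhase f ε ^ 2 / (Real.sqrt ((2 : ℝ) ^ n) : ℝ) := by
    have hterm : ∀ x, (if f x then -1 else 1) * groverEigen f ε x = groverPhase f ε *
        if f x then ((1 / (2 * Real.sqrt (wt f)) : ℝ) * (ε * Complex.I) : ℂ)
        else (1 / (2 * Real.sqrt (2 ^ n - wt f)) : ℝ) := by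
      intro x
      rw [groverEigen]
      split_ifs <;> ring
    have h1 : (wt f : ℂ) * ((1 / (2 * Real.sqrt (wt f)) : ℝ) : ℂ) = (Real.sqrt (wt f) / 2 : ℝ) := by
      exact_mod_cast congrArg (fun r : ℝ => (r : ℂ))
        (mul_one_div_two_mul_sqrt (Nat.cast_nonneg (wt f)))
    have h2 : ((2 : ℂ) ^ n - wt f) * ((1 / (2 * Real.sqrt (2 ^ n - wt f)) : ℝ) : ℂ) =
        (Real.sqrt (2 ^ n - wt f) / 2 : ℝ) := by
      rw [← mul_one_div_two_mul_sqrt (by linarith : (0 : ℝ) ≤ 2 ^ n - wt f)]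
      push_cast
      ring
    have h3 : groverPhase f ε = ((Real.sqrt (2 ^ n - wt f) : ℝ) + (Real.sqrt (wt f) : ℝ) *
        (ε * Complex.I)) / (Real.sqrt ((2 : ℝ) ^ n) : ℝ) := by
      rw [hu]
      simp only [groverPhase]
      push_cast
      ring
    rw [Finset.sum_congr rfl fun x _ => hterm x, ← Finset.mul_sum, sum_ite_eq_wt, h2,
      ← mul_assoc (wt f : ℂ), h1]
    have h4 : (Real.sqrt (wt f) / 2 : ℝ) * (ε * Complex.I) + (Real.sqrt (2 ^ n - wt f) / 2 : ℝ) =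
        groverPhase f ε * (Real.sqrt ((2 : ℝ) ^ n) : ℝ) / 2 := by
      rw [h3, div_mul_cancel₀ _ hNC]
      push_cast
      ring
    rw [h4]
    have hcard : (Fintype.card (Bits n) : ℂ) = 2 ^ n := by simp
    rw [hcard, ← hNNC]
    field_simp
  rw [diffusion_mulVec_apply, hsum]
  have hεC : (ε : ℂ) ^ 2 = 1 := by exact_mod_cast hε
  cases hfx : f x
  · have hb : 0 < Real.sqrt ((2 : ℝ) ^ n - wt f) := by
      have : (wt f : ℝ) < 2 ^ n := by exact_mod_cast wt_lt_of_eq_false hfx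
      exact Real.sqrt_pos.mpr (by linarith)
    have hbC : ((Real.sqrt ((2 : ℝ) ^ n - wt f) : ℝ) : ℂ) ≠ 0 := by exact_mod_cast hb.ne'
    have h := one_add_groverPhase_sq f hε
    have hre : ((groverPhase f ε).re : ℂ) =
        (Real.sqrt ((2 : ℝ) ^ n - wt f) : ℝ) / (Real.sqrt ((2 : ℝ) ^ n) : ℝ) := by
      simp [groverPhase]
    rw [hre] at h
    have h' : groverPhase f ε ^ 2 = 2 * ((Real.sqrt ((2 : ℝ) ^ n - wt f) : ℝ) /
        (Real.sqrt ((2 : ℝ) ^ n) : ℝ)) * groverPhase f ε - 1 := by rw [← h]; ring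
    have h5 : groverPhase f ε ^ 2 * groverEigen f ε x = (2 * ((Real.sqrt ((2 : ℝ) ^ n - wt f) : ℝ) /
        (Real.sqrt ((2 : ℝ) ^ n) : ℝ)) * groverPhase f ε - 1) * groverEigen f ε x := by
      rw [h']
    rw [h5]
    simp only [groverEigen, hfx]
    simp
    field_simp
  · have hb : 0 < Real.sqrt (wt f : ℝ) :=
      Real.sqrt_pos.mpr (by exact_mod_cast wt_pos_of_eq_true hfx)
    have hbC : ((Real.sqrt (wt f : ℝ) : ℝ) : ℂ) ≠ 0 := by exact_mod_cast hb.ne'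
    have h := one_sub_groverPhase_sq f hε
    have him : ((groverPhase f ε).im : ℂ) =
        ε * ((Real.sqrt (wt f) : ℝ) / (Real.sqrt ((2 : ℝ) ^ n) : ℝ)) := by
      simp [groverPhase]
    rw [him] at h
    have h' : groverPhase f ε ^ 2 = 1 + 2 * Complex.I * (ε * ((Real.sqrt (wt f) : ℝ) /
        (Real.sqrt ((2 : ℝ) ^ n) : ℝ))) * groverPhase f ε := by linear_combination -h
    have h5 : groverPhase f ε ^ 2 * groverEigen f ε x = (1 + 2 * Complex.I *
        (ε * ((Real.sqrt (wt f) : ℝ) / (Real.sqrt ((2 : ℝ) ^ n) : ℝ))) * groverPhase f ε) *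
          groverEigen f ε x := by rw [h']
    rw [h5]
    simp only [groverEigen, hfx]
    simp
    field_simp
    linear_combination 2 * groverPhase f ε ^ 2 * Real.sqrt (wt f) * ε ^ 2 * Complex.I_sq -
      2 * groverPhase f ε ^ 2 * Real.sqrt (wt f) * hεC

/-- The factor `groverPhase f ε` in `groverEigen` is chosen so that the two eigenvectors add up to
the uniform superposition. -/
theorem grover_eq (f : Bits n → Bool) (t : ℕ) (x : Bits n) :
    grover f t x = groverEigen f 1 x * (groverPhase f 1 ^ 2) ^ t +
      groverEigen f (-1) x * (groverPhase f (-1) ^ 2) ^ t := by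
  induction t generalizing x with
  | zero =>
    have hN : 0 < Real.sqrt ((2 : ℝ) ^ n) := by positivity
    have hNC : ((Real.sqrt ((2 : ℝ) ^ n) : ℝ) : ℂ) ≠ 0 := by exact_mod_cast hN.ne'
    have hu : ∀ ε : ℝ, groverPhase f ε = (Real.sqrt (2 ^ n - wt f) / Real.sqrt (2 ^ n) : ℝ) +
        (ε * (Real.sqrt (wt f) / Real.sqrt (2 ^ n)) : ℝ) * Complex.I := fun ε =>
      (Complex.re_add_im (groverPhase f ε)).symm
    simp only [grover, pow_zero, mul_one, groverEigen, hu]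
    cases hfx : f x
    · have hb : 0 < Real.sqrt ((2 : ℝ) ^ n - wt f) := by
        have : (wt f : ℝ) < 2 ^ n := by exact_mod_cast wt_lt_of_eq_false hfx
        exact Real.sqrt_pos.mpr (by linarith)
      have hbC : ((Real.sqrt ((2 : ℝ) ^ n - wt f) : ℝ) : ℂ) ≠ 0 := by exact_mod_cast hb.ne'
      simp
      field_simp
      ring
    · have hb : 0 < Real.sqrt (wt f : ℝ) :=
        Real.sqrt_pos.mpr (by exact_mod_cast wt_pos_of_eq_true hfx)
      have hbC : ((Real.sqrt (wt f : ℝ) : ℝ) : ℂ) ≠ 0 := by exact_mod_cast hb.ne'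
      simp
      field_simp
      linear_combination 2 * (Real.sqrt (wt f) : ℂ) * Complex.I_sq
  | succ t ih =>
    rw [grover]
    have : (fun x => (if f x then -1 else 1) * grover f t x) =
        (groverPhase f 1 ^ 2) ^ t • (fun x => (if f x then -1 else 1) * groverEigen f 1 x) +
        (groverPhase f (-1) ^ 2) ^ t • fun x => (if f x then -1 else 1) * groverEigen f (-1) x := by
      funext x
      simp only [ih, Pi.add_apply, Pi.smul_apply, smul_eq_mul]
      ring
    rw [this, mulVec_add, mulVec_smul, mulVec_smul, Pi.add_apply, Pi.smul_apply, Pi.smul_apply,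
      diffusion_mulVec_groverEigen f (by norm_num), diffusion_mulVec_groverEigen f (by norm_num)]
    simp only [smul_eq_mul]
    ring

end GroverEigen

/-! ### Fourier transform and phase estimation -/

section Fourier

variable {L : ℕ} [NeZero L]

/-- The discrete Fourier transform on `ZMod L`, normalised to be unitary. -/
noncomputable def fourier (L : ℕ) [NeZero L] : Matrix (ZMod L) (ZMod L) ℂ :=
  Matrix.of fun z j => ((1 / Real.sqrt L : ℝ) : ℂ) * ZMod.stdAddChar (-(z * j))

theorem fourier_mem_unitaryGroup : fourier L ∈ unitaryGroup (ZMod L) ℂ := by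
  have hL : ((Real.sqrt L : ℝ) : ℂ) * (Real.sqrt L : ℝ) = L := by
    exact_mod_cast Real.mul_self_sqrt (Nat.cast_nonneg L)
  have hL0 : (L : ℂ) ≠ 0 := by exact_mod_cast NeZero.ne L
  rw [mem_unitaryGroup_iff]
  ext y z
  have hterm : ∀ j, fourier L y j * star (fourier L) j z =
      (L : ℂ)⁻¹ * ZMod.stdAddChar (j * (z - y)) := by
    intro j
    have hconj : star (ZMod.stdAddChar (-(z * j)) : ℂ) = ZMod.stdAddChar (z * j) := by
      rw [RCLike.star_def, ← AddChar.map_neg_eq_conj, neg_neg]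
    rw [star_apply]
    simp only [fourier, of_apply, star_mul', hconj]
    rw [show j * (z - y) = -(y * j) + z * j by ring, AddChar.map_add_eq_mul, ← hL]
    simp
    ring
  rw [mul_apply, Finset.sum_congr rfl fun j _ => hterm j, ← Finset.mul_sum,
    AddChar.sum_mulShift _ (ZMod.isPrimitive_stdAddChar L), one_apply]
  by_cases h : y = z
  · simp [h, hL0]
  · simp [h, sub_eq_zero, Ne.symm h]

/-- The Fourier transform diagonalises the cyclic shift. -/
theorem fourier_mulVec_shift (v : ZMod L → ℂ) (z : ZMod L) :
    (fourier L *ᵥ fun j => v (j + 1)) z = ZMod.stdAddChar z * (fourier L *ᵥ v) z := by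
  simp only [mulVec, dotProduct, fourier, of_apply, Finset.mul_sum]
  refine Fintype.sum_equiv (Equiv.addRight 1) _ _ fun j => ?_
  rw [Equiv.coe_addRight, show -(z * j) = z + -(z * (j + 1)) by ring, AddChar.map_add_eq_mul]
  ring

/-- Phase estimation: if the shift acts on `v` almost as multiplication by `μ`, then the outcome of
measuring `v` in the Fourier basis is likely to have a phase close to `μ`. -/
theorem sum_phase_sub_sq (v : ZMod L → ℂ) (μ : ℂ) :
    ∑ z, ‖ZMod.stdAddChar z - μ‖ ^ 2 * ‖(fourier L *ᵥ v) z‖ ^ 2 =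
      ∑ j, ‖v (j + 1) - μ * v j‖ ^ 2 := by
  rw [← sum_normSq_mulVec fourier_mem_unitaryGroup]
  refine Finset.sum_congr rfl fun z _ => ?_
  have : (fun j => v (j + 1) - μ * v j) = (fun j => v (j + 1)) - μ • v := rfl
  rw [this, mulVec_sub, mulVec_smul, Pi.sub_apply, fourier_mulVec_shift, Pi.smul_apply,
    smul_eq_mul, ← sub_mul, norm_mul, mul_pow]

end Fourier

/-! ### The parabolic window -/

section Window

theorem sum_range_sq_mul_sq (L : ℝ) (n : ℕ) :
    ∑ j ∈ Finset.range n, ((j : ℝ) * (L - j)) ^ 2 =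
      n * (n - 1) * (2 * n - 1) / 6 * L ^ 2 - 2 * L * (n * (n - 1) / 2) ^ 2 +
        n * (n - 1) * (2 * n - 1) * (3 * n ^ 2 - 3 * n - 1) / 30 := by
  induction n with
  | zero => simp
  | succ n ih =>
    rw [Finset.sum_range_succ, ih]
    push_cast
    ring

theorem sum_zmod_val (L : ℕ) [NeZero L] (g : ℕ → ℝ) :
    ∑ j : ZMod L, g j.val = ∑ j ∈ Finset.range L, g j := by
  refine Finset.sum_bij' (fun j _ => j.val) (fun j _ => (j : ZMod L)) ?_ ?_ ?_ ?_ ?_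
  · intro j _
    exact Finset.mem_range.mpr j.val_lt
  · simp
  · simp
  · intro j hj
    exact ZMod.val_cast_of_lt (Finset.mem_range.mp hj)
  · simp

/-- A parabolic window of unit norm: modulating it by `λ` with `|λ| = 1` gives an approximate
eigenvector of the cyclic shift. -/
theorem exists_window (L : ℕ) [NeZero L] (hL : 2 ≤ L) :
    ∃ a : ZMod L → ℝ, ∑ j, a j ^ 2 = 1 ∧ ∀ μ : ℂ, ‖μ‖ = 1 →
      ∑ j : ZMod L, ‖(a (j + 1) : ℂ) * μ ^ (j + 1).val - μ * (a j * μ ^ j.val)‖ ^ 2 ≤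
        32 / (L : ℝ) ^ 2 := by
  have hL' : (2 : ℝ) ≤ L := by exact_mod_cast hL
  set W : ℝ := ∑ j : ZMod L, ((j.val : ℝ) * (L - j.val)) ^ 2 with hW
  have hWval : W = L * (L ^ 4 - 1) / 30 := by
    rw [hW, sum_zmod_val L (fun j => ((j : ℝ) * (L - j)) ^ 2), sum_range_sq_mul_sq]
    ring
  -- The constant 32 is tight at `L = 2`: the bound amounts to `16 ≤ L ^ 4`.
  have hWlow : (L : ℝ) ^ 5 / 32 ≤ W := by
    rw [hWval]
    have : (2 : ℝ) ^ 4 ≤ (L : ℝ) ^ 4 := by gcongr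
    nlinarith
  have hWpos : 0 < W := lt_of_lt_of_le (by positivity) hWlow
  have hsq : Real.sqrt W ^ 2 = W := Real.sq_sqrt hWpos.le
  refine ⟨fun j => (j.val : ℝ) * (L - j.val) / Real.sqrt W, ?_, fun μ hμ => ?_⟩
  · simp only [div_pow, hsq]
    rw [← Finset.sum_div, ← hW, div_self hWpos.ne']
  · have hbound : ∀ j : ZMod L,
        ‖(((((j + 1).val : ℝ) * (L - (j + 1).val) / Real.sqrt W : ℝ)) : ℂ) * μ ^ (j + 1).val -
          μ * (((j.val : ℝ) * (L - j.val) / Real.sqrt W : ℝ) * μ ^ j.val)‖ ^ 2 ≤ L ^ 2 / W := by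
      intro j
      have hj : j.val < L := j.val_lt
      have hj' : (j.val : ℝ) + 1 ≤ L := by exact_mod_cast hj
      have hdiff : ‖(((((j + 1).val : ℝ) * (L - (j + 1).val) / Real.sqrt W : ℝ)) : ℂ) *
          μ ^ (j + 1).val - μ * (((j.val : ℝ) * (L - j.val) / Real.sqrt W : ℝ) * μ ^ j.val)‖ =
            |(L : ℝ) - 2 * (j.val : ℝ) - 1| / Real.sqrt W := by
        -- At the wrap-around the phase jumps from `μ ^ (L - 1)` to `μ ^ 0`, but the window vanishes
        -- at 0, so the jump costs nothing.
        rcases eq_or_ne (j.val + 1) L with h | h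
        · have h1 : (j + 1).val = 0 := by
            have : j + 1 = 0 := by
              rw [← ZMod.natCast_zmod_val j, ← Nat.cast_one, ← Nat.cast_add, h, ZMod.natCast_self]
            rw [this, ZMod.val_zero]
          have h2 : (L : ℝ) = j.val + 1 := by exact_mod_cast h.symm
          rw [h1, Nat.cast_zero, zero_mul, zero_div, Complex.ofReal_zero, zero_mul, zero_sub,
            norm_neg, norm_mul, norm_mul, norm_pow, hμ, one_pow, mul_one, one_mul,
            Complex.norm_real, Real.norm_eq_abs, abs_div, abs_of_nonneg (Real.sqrt_nonneg W), h2,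
            ← abs_neg]
          congr 2
          ring
        · have h1 : (j + 1).val = j.val + 1 := by
            have h3 : j + 1 = ((j.val + 1 : ℕ) : ZMod L) := by simp
            rw [h3, ZMod.val_cast_of_lt (by omega)]
          rw [h1, pow_succ', show ∀ x y : ℝ, (x : ℂ) * (μ * μ ^ j.val) - μ * (y * μ ^ j.val) =
            ((x - y : ℝ) : ℂ) * (μ * μ ^ j.val) by intros; push_cast; ring, norm_mul, norm_mul,
            norm_pow, hμ, one_pow, mul_one, mul_one, Complex.norm_real, Real.norm_eq_abs, ← sub_div,
            abs_div, abs_of_nonneg (Real.sqrt_nonneg W)]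
          congr 2
          push_cast
          ring
      rw [hdiff, div_pow, hsq, sq_abs]
      have h0 : (0 : ℝ) ≤ j.val := Nat.cast_nonneg _
      gcongr ?_ / W
      nlinarith
    calc _ ≤ ∑ _j : ZMod L, (L : ℝ) ^ 2 / W := Finset.sum_le_sum fun j _ => hbound j
      _ = L ^ 3 / W := by simp [ZMod.card]; ring
      _ ≤ L ^ 3 / (L ^ 5 / 32) := by gcongr
      _ = 32 / (L : ℝ) ^ 2 := by field_simp

end Window

/-! ### Majority vote -/

section Majority

variable {ι : Type*} [Fintype ι]

/-- If each of `R` independent samples lies in the set given by `bad` with probability at most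
`1 / 16`, then at least half of them do with probability at most `2⁻ᴿ`. -/
theorem sum_majority_le (q : ι → ℝ) (hq : ∀ z, 0 ≤ q z) (hq1 : ∑ z, q z = 1)
    (bad : ι → Prop) [DecidablePred bad] (hbad : ∑ z, (if bad z then q z else 0) ≤ 1 / 16) (R : ℕ)
    (S : Finset (Fin R → ι))
    (hS : ∀ y ∈ S, R ≤ 2 * (Finset.univ.filter fun r => bad (y r)).card) :
    ∑ y ∈ S, ∏ r, q (y r) ≤ (1 / 2) ^ R := by
  -- Exponential Markov bound: weighting each bad sample by 16 gives a factor of at least `16 ^ (R /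
  -- 2) = 4 ^ R` on `S`, while the mean weight per sample is at most `1 + 15 / 16 ≤ 2`.
  have hterm : ∀ y ∈ S, ∏ r, q (y r) ≤
      (1 / 4) ^ R * ∏ r, (q (y r) * if bad (y r) then 16 else 1) := by
    intro y hy
    have h0 : 0 ≤ ∏ r, q (y r) := Finset.prod_nonneg fun r _ => hq _
    have h1 : (∏ r, if bad (y r) then (16 : ℝ) else 1) =
        4 ^ (2 * (Finset.univ.filter fun r => bad (y r)).card) := by
      rw [Finset.prod_ite, Finset.prod_const, Finset.prod_const_one, mul_one, pow_mul]
      norm_num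
    have h2 : (4 : ℝ) ^ R ≤ 4 ^ (2 * (Finset.univ.filter fun r => bad (y r)).card) :=
      pow_le_pow_right₀ (by norm_num) (hS y hy)
    rw [Finset.prod_mul_distrib, h1]
    calc ∏ r, q (y r) = (1 / 4) ^ R * ((∏ r, q (y r)) * 4 ^ R) := by
          rw [mul_left_comm, ← mul_pow]; norm_num
      _ ≤ _ := by gcongr
  have hsum : ∑ z, q z * (if bad z then 16 else 1) ≤ 2 := by
    have : ∀ z, q z * (if bad z then 16 else 1) = q z + 15 * if bad z then q z else 0 := by
      intro z
      split_ifs <;> ring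
    rw [Finset.sum_congr rfl fun z _ => this z, Finset.sum_add_distrib, hq1, ← Finset.mul_sum]
    linarith
  have hpos : ∀ z, 0 ≤ q z * (if bad z then 16 else 1) := by
    intro z
    have := hq z
    split_ifs <;> positivity
  have hpow : (∑ z, q z * (if bad z then 16 else 1)) ^ R ≤ 2 ^ R :=
    pow_le_pow_left₀ (Finset.sum_nonneg fun z _ => hpos z) hsum R
  rw [Fintype.sum_pow] at hpow
  have hall : ∑ y ∈ S, ∏ r, (q (y r) * if bad (y r) then 16 else 1) ≤
      ∑ y : Fin R → ι, ∏ r, (q (y r) * if bad (y r) then 16 else 1) :=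
    Finset.sum_le_univ_sum_of_nonneg fun y => Finset.prod_nonneg fun r _ => hpos (y r)
  have hhalf : ((1 : ℝ) / 4) ^ R * 2 ^ R = (1 / 2) ^ R := by
    rw [← mul_pow]
    norm_num
  refine (Finset.sum_le_sum hterm).trans ?_
  rw [← Finset.mul_sum, ← hhalf]
  exact mul_le_mul_of_nonneg_left (hall.trans hpow) (by positivity)

end Majority

/-! ### Joint measurement of several control registers -/

section TensorPower

variable {κ : Type*} [Fintype κ]

/-- The `R`-fold tensor power of a matrix. -/
def tensorPower (M : Matrix κ κ ℂ) (R : ℕ) : Matrix (Fin R → κ) (Fin R → κ) ℂ :=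
  Matrix.of fun y w => ∏ r, M (y r) (w r)

theorem tensorPower_mem_unitaryGroup [DecidableEq κ] {M : Matrix κ κ ℂ} (hM : M ∈ unitaryGroup κ ℂ) (R : ℕ) :
    tensorPower M R ∈ unitaryGroup (Fin R → κ) ℂ := by
  rw [mem_unitaryGroup_iff]
  ext y z
  have h : ∀ i j, ∑ k, M i k * star (M j k) = if i = j then 1 else 0 := by
    intro i j
    have := congrFun (congrFun (mem_unitaryGroup_iff.mp hM) i) j
    simpa only [mul_apply, star_apply, one_apply] using this
  simp only [mul_apply, star_apply, tensorPower, of_apply, star_prod, ← Finset.prod_mul_distrib]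
  rw [← Fintype.prod_sum (fun r k => M (y r) k * star (M (z r) k))]
  simp only [h, one_apply, funext_iff]
  by_cases hyz : ∀ r, y r = z r
  · simp [hyz]
  · rw [if_neg hyz]
    obtain ⟨r, hr⟩ := not_forall.mp hyz
    exact Finset.prod_eq_zero (Finset.mem_univ r) (if_neg hr)

theorem submatrix_mem_unitaryGroup [DecidableEq κ] {ι : Type*} [Fintype ι] [DecidableEq ι]
    {M : Matrix κ κ ℂ} (hM : M ∈ unitaryGroup κ ℂ) (e : ι ≃ κ) : M.submatrix e e ∈ unitaryGroup ι ℂ := by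
  rw [mem_unitaryGroup_iff, star_eq_conjTranspose, conjTranspose_submatrix, submatrix_mul_equiv,
    ← star_eq_conjTranspose, mem_unitaryGroup_iff.mp hM, submatrix_one_equiv]

theorem tensorPower_sum_mul_pow (M : Matrix κ κ ℂ) (R : ℕ) (a : κ → ℂ) (p : κ → ℕ) (μ : ℂ)
    (y : Fin R → κ) :
    ∑ w : Fin R → κ, tensorPower M R y w * ((∏ r, a (w r)) * μ ^ ∑ r, p (w r)) =
      ∏ r, (M *ᵥ fun j => a j * μ ^ p j) (y r) := by
  simp only [mulVec, dotProduct]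
  rw [Fintype.prod_sum (fun r j => M (y r) j * (a j * μ ^ p j))]
  refine Finset.sum_congr rfl fun w _ => ?_
  rw [Finset.prod_mul_distrib, Finset.prod_mul_distrib, Finset.prod_pow_eq_pow_sum]
  rfl

variable {n : ℕ}

theorem norm_add_sq_le_two_mul (A B : ℂ) : ‖A + B‖ ^ 2 ≤ 2 * ‖A‖ ^ 2 + 2 * ‖B‖ ^ 2 := by
  have h := norm_add_le A B
  have h0 := norm_nonneg (A + B)
  nlinarith [sq_nonneg (‖A‖ - ‖B‖)]

/-- The measurement statistics of the control register are dominated by the sum of those for the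
two eigenvalues of the Grover iteration. -/
theorem sum_measure_le (M : Matrix κ κ ℂ) (R : ℕ) (a : κ → ℂ) (p : κ → ℕ) (f : Bits n → Bool)
    (S : Finset (Fin R → κ)) :
    ∑ x, ∑ y ∈ S, ‖∑ w : Fin R → κ, tensorPower M R y w *
        ((∏ r, a (w r)) * grover f (∑ r, p (w r)) x)‖ ^ 2 ≤
      ∑ y ∈ S, ∏ r, ‖(M *ᵥ fun j => a j * (groverPhase f 1 ^ 2) ^ p j) (y r)‖ ^ 2 +
        ∑ y ∈ S, ∏ r, ‖(M *ᵥ fun j => a j * (groverPhase f (-1) ^ 2) ^ p j) (y r)‖ ^ 2 := by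
  set B : ℝ → (Fin R → κ) → ℂ := fun ε y =>
    ∏ r, (M *ᵥ fun j => a j * (groverPhase f ε ^ 2) ^ p j) (y r) with hB
  have hamp : ∀ x y, ∑ w : Fin R → κ, tensorPower M R y w *
      ((∏ r, a (w r)) * grover f (∑ r, p (w r)) x) =
        groverEigen f 1 x * B 1 y + groverEigen f (-1) x * B (-1) y := by
    intro x y
    simp only [hB, ← tensorPower_sum_mul_pow, Finset.mul_sum, ← Finset.sum_add_distrib]
    refine Finset.sum_congr rfl fun w _ => ?_
    rw [grover_eq]
    ring
  have hprod : ∀ ε y, ∏ r, ‖(M *ᵥ fun j => a j * (groverPhase f ε ^ 2) ^ p j) (y r)‖ ^ 2 =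
      ‖B ε y‖ ^ 2 := by
    intro ε y
    rw [hB, norm_prod, Finset.prod_pow]
  simp only [hamp, hprod]
  have hS : ∀ ε, 0 ≤ ∑ y ∈ S, ‖B ε y‖ ^ 2 := fun ε => Finset.sum_nonneg fun y _ => by positivity
  have h1 := sum_normSq_groverEigen_le f (ε := 1) (by norm_num)
  have h2 := sum_normSq_groverEigen_le f (ε := -1) (by norm_num)
  calc ∑ x, ∑ y ∈ S, ‖groverEigen f 1 x * B 1 y + groverEigen f (-1) x * B (-1) y‖ ^ 2
      ≤ ∑ x, ∑ y ∈ S, (2 * ‖groverEigen f 1 x‖ ^ 2 * ‖B 1 y‖ ^ 2 +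
          2 * ‖groverEigen f (-1) x‖ ^ 2 * ‖B (-1) y‖ ^ 2) := by
        refine Finset.sum_le_sum fun x _ => Finset.sum_le_sum fun y _ => ?_
        refine (norm_add_sq_le_two_mul _ _).trans (le_of_eq ?_)
        rw [norm_mul, norm_mul]
        ring
    _ = 2 * (∑ x, ‖groverEigen f 1 x‖ ^ 2) * ∑ y ∈ S, ‖B 1 y‖ ^ 2 +
          2 * (∑ x, ‖groverEigen f (-1) x‖ ^ 2) * ∑ y ∈ S, ‖B (-1) y‖ ^ 2 := by
        simp only [Finset.sum_add_distrib, ← Finset.mul_sum, ← Finset.sum_mul]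
    -- The squared norms, at most `1 / 2`, absorb the factor 2 from the cross terms, so
    -- orthogonality of the eigenvectors is not needed.
    _ ≤ 1 * ∑ y ∈ S, ‖B 1 y‖ ^ 2 + 1 * ∑ y ∈ S, ‖B (-1) y‖ ^ 2 := by
        have := hS 1
        have := hS (-1)
        gcongr <;> linarith
    _ = _ := by rw [one_mul, one_mul]

/-- Total probability 1, which turns an upper bound on rejection into a lower bound on acceptance.
-/
theorem sum_measure_univ [DecidableEq κ] {M : Matrix κ κ ℂ} (hM : M ∈ unitaryGroup κ ℂ) (R : ℕ) (a : κ → ℂ)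
    (ha : ∑ j, ‖a j‖ ^ 2 = 1) (p : κ → ℕ) (f : Bits n → Bool) :
    ∑ x, ∑ y, ‖∑ w : Fin R → κ, tensorPower M R y w *
        ((∏ r, a (w r)) * grover f (∑ r, p (w r)) x)‖ ^ 2 = 1 := by
  have h : ∀ x, ∑ y, ‖∑ w : Fin R → κ, tensorPower M R y w *
      ((∏ r, a (w r)) * grover f (∑ r, p (w r)) x)‖ ^ 2 =
        ∑ w : Fin R → κ, ‖(∏ r, a (w r)) * grover f (∑ r, p (w r)) x‖ ^ 2 := fun x =>
    sum_normSq_mulVec (tensorPower_mem_unitaryGroup hM R) fun w =>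
      (∏ r, a (w r)) * grover f (∑ r, p (w r)) x
  simp only [h, norm_mul, mul_pow]
  rw [Finset.sum_comm]
  simp only [← Finset.mul_sum, sum_normSq_grover, mul_one, norm_prod, ← Finset.prod_pow]
  rw [← Fintype.sum_pow (fun j => ‖a j‖ ^ 2), ha, one_pow]

end TensorPower

/-! ### Deciding the weight -/

section Decision

/-- Chebyshev's inequality applied to `sum_phase_sub_sq`. -/
theorem sum_far_phase_le {L : ℕ} [NeZero L] {a : ZMod L → ℝ} {μ : ℂ}
    (ha : ∑ j : ZMod L, ‖(a (j + 1) : ℂ) * μ ^ (j + 1).val - μ * (a j * μ ^ j.val)‖ ^ 2 ≤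
      32 / (L : ℝ) ^ 2) {η : ℝ} (hη : 0 < η) (hL : 32 / η ≤ L)
    (bad : ZMod L → Prop) [DecidablePred bad] (hbad : ∀ z, bad z → η ≤ ‖ZMod.stdAddChar z - μ‖) :
    ∑ z, (if bad z then ‖(fourier L *ᵥ fun j => (a j : ℂ) * μ ^ j.val) z‖ ^ 2 else 0) ≤
      1 / 16 := by
  have hsum := (sum_phase_sub_sq (fun j : ZMod L => (a j : ℂ) * μ ^ j.val) μ).trans_le ha
  have h1 : η ^ 2 *
      ∑ z, (if bad z then ‖(fourier L *ᵥ fun j => (a j : ℂ) * μ ^ j.val) z‖ ^ 2 else 0) ≤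
        32 / (L : ℝ) ^ 2 := by
    refine le_trans ?_ hsum
    rw [Finset.mul_sum]
    refine Finset.sum_le_sum fun z _ => ?_
    split_ifs with hz
    · have := hbad z hz
      gcongr
    · rw [mul_zero]
      positivity
  have h2 : 32 / (L : ℝ) ^ 2 ≤ η ^ 2 * (1 / 16) := by
    have hpos : 0 < 32 / η := by positivity
    calc 32 / (L : ℝ) ^ 2 ≤ 32 / (32 / η) ^ 2 := by gcongr
      _ = η ^ 2 * (1 / 32) := by field_simp
      _ ≤ η ^ 2 * (1 / 16) := by gcongr; norm_num
  exact le_of_mul_le_mul_left (h1.trans h2) (by positivity)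

/-- Estimating the phase of the Grover iteration `R` times and taking a majority vote decides the
weight with error probability at most `2 · 2⁻ᴿ`. -/
theorem exists_queryAlgorithm_majority (n k₁ k₂ R : ℕ) (hk : k₁ < k₂) (hk₂ : k₂ ≤ 2 ^ n)
    (hR : 1 ≤ R) :
    ∃ A : QueryAlgorithm n, A.DecidesWeight k₁ k₂ (2 * (1 / 2) ^ R) ∧
      (A.queries : ℝ) ≤ 64 * R * (Real.sqrt ((2 : ℝ) ^ n) / (Real.sqrt k₂ - Real.sqrt k₁)) := by
  set N : ℝ := Real.sqrt ((2 : ℝ) ^ n) with hN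
  have hNpos : 0 < N := Real.sqrt_pos.mpr (by positivity)
  set η : ℝ := (Real.sqrt k₂ - Real.sqrt k₁) / N with hη
  have hsub : 0 < Real.sqrt k₂ - Real.sqrt k₁ :=
    sub_pos.mpr (Real.sqrt_lt_sqrt (Nat.cast_nonneg _) (by exact_mod_cast hk))
  have hηpos : 0 < η := div_pos hsub hNpos
  have hη1 : η ≤ 1 := by
    rw [hη, div_le_one hNpos]
    have h1 : Real.sqrt k₂ ≤ N := Real.sqrt_le_sqrt (by exact_mod_cast hk₂)
    have := Real.sqrt_nonneg (k₁ : ℝ)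
    linarith
  -- A power of two between `32 / η` and `64 / η` is taken for `L`, so that `R` copies of `ZMod L`
  -- can be encoded by bit strings; any bijection will do.
  obtain ⟨l, hl1, hl2⟩ := exists_nat_pow_near (x := 32 / η) (y := 2)
    ((one_le_div hηpos).mpr (by linarith)) one_lt_two
  let L : ℕ := 2 ^ (l + 1)
  have hLdef : L = 2 ^ (l + 1) := rfl
  have : NeZero L := ⟨by positivity⟩
  have hL2 : 2 ≤ L := by
    have : 1 ≤ 2 ^ l := Nat.one_le_two_pow
    rw [hLdef, pow_succ]
    omega
  have hLlow : 32 / η ≤ (L : ℝ) := by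
    rw [hLdef]
    push_cast
    exact hl2.le
  have hLup : (L : ℝ) ≤ 64 / η := by
    rw [hLdef]
    push_cast
    rw [pow_succ]
    calc (2 : ℝ) ^ l * 2 ≤ 32 / η * 2 := by gcongr
      _ = 64 / η := by ring
  obtain ⟨a, ha1, ha⟩ := exists_window L hL2
  have ha1' : ∑ j, ‖(a j : ℂ)‖ ^ 2 = 1 := by
    simpa only [Complex.norm_real, Real.norm_eq_abs, sq_abs] using ha1
  let e : Bits ((l + 1) * R) ≃ (Fin R → ZMod L) := Fintype.equivOfCardEq (by
    simp [ZMod.card, hLdef, pow_mul])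
  -- Midpoint of `2√k₁ / N` and `2√k₂ / N`, at distance `η` from both.
  set mid : ℝ := (Real.sqrt k₁ + Real.sqrt k₂) / N with hmid
  let high : ZMod L → Prop := fun z => mid ≤ ‖1 - (ZMod.stdAddChar z : ℂ)‖
  have : DecidablePred high := Classical.decPred _
  let S : Finset (Fin R → ZMod L) := Finset.univ.filter fun y =>
    R ≤ 2 * (Finset.univ.filter fun r => high (y r)).card
  let p : (Fin R → ZMod L) → ℕ := fun w => ∑ r, (w r).val
  have hpow : ∑ w : Bits ((l + 1) * R), ‖∏ r, (a (e w r) : ℂ)‖ ^ 2 = 1 := by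
    rw [e.sum_comp (fun w => ‖∏ r, (a (w r) : ℂ)‖ ^ 2)]
    simp only [norm_prod, ← Finset.prod_pow]
    rw [← Fintype.sum_pow (fun j => ‖(a j : ℂ)‖ ^ 2), ha1', one_pow]
  have hple : ∀ w, p (e w) ≤ R * (L - 1) := by
    intro w
    calc p (e w) ≤ ∑ _r : Fin R, (L - 1) :=
          Finset.sum_le_sum fun r _ => Nat.le_sub_one_of_lt (ZMod.val_lt _)
      _ = R * (L - 1) := by simp
  obtain ⟨A, hAq, hA⟩ := exists_queryAlgorithm_controlled_grover n
    (fun w => ∏ r, (a (e w r) : ℂ)) hpow (fun w => p (e w)) (R * (L - 1)) hple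
    (submatrix_mem_unitaryGroup (tensorPower_mem_unitaryGroup (fourier_mem_unitaryGroup (L := L)) R)
      e) (fun y => decide (e y ∈ S))
  have hacc : ∀ f : Bits n → Bool, A.acceptProb f = ∑ x, ∑ y ∈ S,
      ‖∑ w : Fin R → ZMod L, tensorPower (fourier L) R y w *
        ((∏ r, (a (w r) : ℂ)) * grover f (∑ r, (w r).val) x)‖ ^ 2 := by
    intro f
    rw [hA]
    refine Finset.sum_congr rfl fun x _ => ?_
    have hw : ∀ y, ∑ w, (tensorPower (fourier L) R).submatrix e e y w *
        ((∏ r, (a (e w r) : ℂ)) * grover f (p (e w)) x) =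
          ∑ w : Fin R → ZMod L, tensorPower (fourier L) R (e y) w *
            ((∏ r, (a (w r) : ℂ)) * grover f (∑ r, (w r).val) x) := fun y =>
      e.sum_comp fun w => tensorPower (fourier L) R (e y) w *
        ((∏ r, (a (w r) : ℂ)) * grover f (∑ r, (w r).val) x)
    simp only [hw, decide_eq_true_eq]
    rw [e.sum_comp fun y => if y ∈ S then ‖∑ w : Fin R → ZMod L, tensorPower (fourier L) R y w *
      ((∏ r, (a (w r) : ℂ)) * grover f (∑ r, (w r).val) x)‖ ^ 2 else 0]
    rw [Finset.sum_ite_mem, Finset.univ_inter]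
  have hprob : ∀ (f : Bits n → Bool) (ε : ℝ), ε ^ 2 = 1 →
      ∑ z, ‖(fourier L *ᵥ fun j => (a j : ℂ) * (groverPhase f ε ^ 2) ^ j.val) z‖ ^ 2 = 1 := by
    intro f ε hε
    rw [sum_normSq_mulVec fourier_mem_unitaryGroup, ← ha1']
    refine Finset.sum_congr rfl fun j _ => ?_
    rw [norm_mul, norm_pow, norm_pow, norm_groverPhase f hε, one_pow, one_pow, mul_one]
  have htail : ∀ (f : Bits n → Bool) (bad : ZMod L → Prop) [DecidablePred bad]
      (_ : ∀ (ε : ℝ), ε ^ 2 = 1 → ∀ z, bad z →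
        η ≤ ‖ZMod.stdAddChar z - groverPhase f ε ^ 2‖)
      (S' : Finset (Fin R → ZMod L))
      (_ : ∀ y ∈ S', R ≤ 2 * (Finset.univ.filter fun r => bad (y r)).card),
      ∑ x, ∑ y ∈ S', ‖∑ w : Fin R → ZMod L, tensorPower (fourier L) R y w *
        ((∏ r, (a (w r) : ℂ)) * grover f (∑ r, (w r).val) x)‖ ^ 2 ≤ 2 * (1 / 2) ^ R := by
    intro f bad _ hbad S' hS'
    have hone : ∀ ε : ℝ, ε ^ 2 = 1 → ∑ y ∈ S', ∏ r, ‖(fourier L *ᵥ fun j => (a j : ℂ) *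
        (groverPhase f ε ^ 2) ^ j.val) (y r)‖ ^ 2 ≤ (1 / 2) ^ R := by
      intro ε hε
      have hμ : ‖groverPhase f ε ^ 2‖ = 1 := by rw [norm_pow, norm_groverPhase f hε, one_pow]
      exact sum_majority_le _ (fun z => by positivity) (hprob f ε hε) bad
        (sum_far_phase_le (ha _ hμ) hηpos hLlow bad (hbad ε hε)) R S' hS'
    refine (sum_measure_le (fourier L) R (fun j => (a j : ℂ)) ZMod.val f S').trans ?_
    have h1 := hone 1 (by norm_num)
    have h2 := hone (-1) (by norm_num)
    linarith
  have hdist : ∀ (f : Bits n → Bool) (ε : ℝ), ε ^ 2 = 1 → ∀ z : ZMod L,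
      |‖1 - (ZMod.stdAddChar z : ℂ)‖ - 2 * (Real.sqrt (wt f) / N)| ≤
        ‖ZMod.stdAddChar z - groverPhase f ε ^ 2‖ := by
    intro f ε hε z
    rw [← norm_one_sub_groverPhase_sq f hε,
      norm_sub_rev (ZMod.stdAddChar z : ℂ) (groverPhase f ε ^ 2)]
    refine (abs_norm_sub_norm_le _ _).trans (le_of_eq ?_)
    congr 1
    ring
  refine ⟨A, fun f => ⟨fun hf => ?_, fun hf => ?_⟩, ?_⟩
  · rw [hacc]
    refine htail f high (fun ε hε z hz => le_trans ?_ (hdist f ε hε z)) S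
      fun y hy => (Finset.mem_filter.mp hy).2
    refine le_trans ?_ (le_abs_self _)
    have h1 : Real.sqrt (wt f) / N ≤ Real.sqrt k₁ / N := by gcongr
    have h2 : mid - 2 * (Real.sqrt k₁ / N) = η := by rw [hmid, hη]; ring
    have h3 : mid ≤ ‖1 - (ZMod.stdAddChar z : ℂ)‖ := hz
    linarith
  -- Ties are accepted, so every rejected outcome has a strict majority of low samples.
  · have hrej := htail f (fun z => ¬ high z) (fun ε hε z hz => le_trans ?_ (hdist f ε hε z)) Sᶜ ?_
    · have htot := sum_measure_univ (fourier_mem_unitaryGroup (L := L)) R (fun j => (a j : ℂ)) ha1'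
        ZMod.val f
      have hsplit := Finset.sum_congr (rfl : (Finset.univ : Finset (Bits n)) = Finset.univ)
        fun x _ => Finset.sum_add_sum_compl S fun y => ‖∑ w : Fin R → ZMod L,
          tensorPower (fourier L) R y w *
            ((∏ r, (a (w r) : ℂ)) * grover f (∑ r, (w r).val) x)‖ ^ 2
      rw [Finset.sum_add_distrib, htot, ← hacc] at hsplit
      linarith
    · refine le_trans ?_ (neg_le_abs _)
      have h1 : Real.sqrt k₂ / N ≤ Real.sqrt (wt f) / N := by gcongr
      have h2 : 2 * (Real.sqrt k₂ / N) - mid = η := by rw [hmid, hη]; ring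
      have h3 : ‖1 - (ZMod.stdAddChar z : ℂ)‖ < mid := not_le.mp hz
      linarith
    · intro y hy
      have h1 : ¬ R ≤ 2 * (Finset.univ.filter fun r => high (y r)).card := by
        simpa [S] using hy
      have h2 := Finset.card_filter_add_card_filter_not (s := Finset.univ) fun r => high (y r)
      rw [Finset.card_univ, Fintype.card_fin] at h2
      omega
  -- The extra query is absorbed because `R * (L - 1) + 1 ≤ R * L` for `R ≥ 1`.
  · have h1 : A.queries ≤ R * L := by
      rw [hAq]
      obtain ⟨L', hL'⟩ : ∃ L', L = L' + 1 := ⟨L - 1, by omega⟩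
      rw [hL', Nat.add_sub_cancel, mul_add, mul_one]
      omega
    calc (A.queries : ℝ) ≤ R * L := by exact_mod_cast h1
      _ ≤ R * (64 / η) := by gcongr
      _ = 64 * R * (N / (Real.sqrt k₂ - Real.sqrt k₁)) := by
        rw [hη]
        field_simp

end Decision

end WeightDecision

/-! ### Choice of the number of repetitions -/

theorem mainTheorem4 :
    ∃ C : ℝ, 0 < C ∧ ∀ (n k₁ k₂ : ℕ) (δ : ℝ), k₁ < k₂ → k₂ ≤ 2 ^ n → 0 < δ → δ < 1 →
      ∃ A : WeightDecision.QueryAlgorithm n,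
        A.DecidesWeight k₁ k₂ δ ∧
        (A.queries : ℝ) ≤
          C * (Real.sqrt ((2 : ℝ) ^ n) / (Real.sqrt (k₂ : ℝ) - Real.sqrt (k₁ : ℝ))) *
            Real.log (1 / δ) := by
  refine ⟨320, by norm_num, fun n k₁ k₂ δ hk hk₂ hδ hδ1 => ?_⟩
  have hsub : 0 < Real.sqrt (k₂ : ℝ) - Real.sqrt (k₁ : ℝ) :=
    sub_pos.mpr (Real.sqrt_lt_sqrt (Nat.cast_nonneg _) (by exact_mod_cast hk))
  have hδinv : 1 ≤ 1 / δ := (one_le_div hδ).mpr hδ1.le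
  have hlog : 0 ≤ Real.log (1 / δ) := Real.log_nonneg hδinv
  -- As `δ` tends to 1 the bound drops below one query, so large `δ` needs an algorithm without
  -- queries: a fair coin.
  rcases le_or_gt (1 / 2) δ with h | h
  · obtain ⟨A, hq, hA⟩ := WeightDecision.exists_queryAlgorithm_coin n
    refine ⟨A, fun f => ⟨fun _ => ?_, fun _ => ?_⟩, ?_⟩
    · rw [hA]
      exact h
    · rw [hA]
      linarith
    · rw [hq, Nat.cast_zero]
      positivity
  · obtain ⟨k, hk1, hk2⟩ := exists_nat_pow_near hδinv one_lt_two
    obtain ⟨A, hA, hq⟩ :=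
      WeightDecision.exists_queryAlgorithm_majority n k₁ k₂ (k + 2) hk hk₂ (by omega)
    have herr : 2 * (1 / 2 : ℝ) ^ (k + 2) ≤ δ := by
      have h1 : 2 * (1 / 2 : ℝ) ^ (k + 2) = 1 / 2 ^ (k + 1) := by
        rw [one_div_pow, pow_succ (2 : ℝ) (k + 1)]
        field_simp
      rw [h1, one_div_le (by positivity) hδ]
      exact hk2.le
    refine ⟨A, fun f => ⟨fun hf => ((hA f).1 hf).trans herr, fun hf => ?_⟩, hq.trans ?_⟩
    · have := (hA f).2 hf
      linarith
    · have hlog2 : Real.log 2 ≤ Real.log (1 / δ) :=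
        Real.log_le_log (by norm_num) ((le_one_div (by norm_num) hδ).mpr h.le)
      have hlogk : k * Real.log 2 ≤ Real.log (1 / δ) := by
        rw [← Real.log_pow]
        exact Real.log_le_log (by positivity) hk1
      have h2 := Real.log_two_gt_d9
      -- Since `δ < 1 / 2`, `(k + 2) log 2 ≤ 3 log (1 / δ)`, and `3 / log 2 < 5`; hence `320 = 64 *
      -- 5`.
      have hR : ((k + 2 : ℕ) : ℝ) ≤ 5 * Real.log (1 / δ) := by
        push_cast
        have hk0 : (0 : ℝ) ≤ k := Nat.cast_nonneg k
        nlinarith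
      calc 64 * ((k + 2 : ℕ) : ℝ) *
            (Real.sqrt ((2 : ℝ) ^ n) / (Real.sqrt (k₂ : ℝ) - Real.sqrt (k₁ : ℝ)))
          ≤ 64 * (5 * Real.log (1 / δ)) *
            (Real.sqrt ((2 : ℝ) ^ n) / (Real.sqrt (k₂ : ℝ) - Real.sqrt (k₁ : ℝ))) := by
            gcongr
        _ = _ := by ring
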